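/- Let $k$ be a field. A nilpotent linear operator is a $k[T]$-module $N_\alpha=\bigoplus_i k[T]/(T^{\alpha_i})$, $\alpha$ a partition. Let $\mathcal S(k)$ be the category of monomorphisms $f:N_\alpha\to N_\beta$ of $k[T]$-modules (a morphism is a pair of $k[T]$-linear maps making the square commute; a sequence is exact if it is exact on subspaces and on ambient spaces), and $\mathcal S_2(k)$ the full subcategory of those with $\alpha_1\le 2$. The partition type of $f:N_\alpha\to N_\beta$ is $(\alpha,\beta,\gamma)$, where $\mathrm{Coker}\, f\cong N_\gamma$. The indecomposable objects of $\mathcal S_2(k)$ are the pickets $P_\ell^m$ (the embedding $k[T]/(T^\ell)\to k[T]/(T^m)$, $1\mapsto T^{m-\ell}$; $m\ge1$, $0\le \ell\le\min\{2,m\}$) and the bipickets $B_2^{m,r}$ (the embedding $k[T]/(T^2)\to k[T]/(T^m)\oplus k[T]/(T^r)$, $1\mapsto (T^{m-2},T^{r-1})$; $1\le r\le m-2$). Write $B_2^{m,m-1}=P_2^m\oplus P_0^{m-1}$ for $m\ge 2$. Every $Y\in\mathcal S_2(k)$ is a direct sum of pickets and bipickets, unique up to isomorphism and order of the summands. Its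 Klein tableau is the union of the tableaux of the summands: $P_\ell^m$ has one column of $m$ boxes, the $\ell$ lowest having entries $1,\dots,\ell$, where an entry $2$ carries the subscript $m-1$; $B_2^{m,r}$ has two columns of $m$ and $r$ boxes, with lowest entries $2_r$ and $1$, respectively. The arc diagram $\Delta(Y)$ has an arc from $m$ to $r$ for each symbol $2_r$ in row $m$ and, if the number of arcs ending at $r$ is less than the number of entries $1$ in row $r$, a pole at $r$ for each remaining entry $1$. For arc diagrams write $\Delta\le_{\rm arc}\Delta'$ if $\Delta$ is obtained from $\Delta'$ by a finite sequence of the following moves, where $m>n>r>s$: - (A) replace arcs $m\to r$, $n\to s$ by arcs $m\to s$, $n\to r$ (called (A$'$) when $n=r+1$); - (B) replace an arc $m\to s$ and a pole at $r$ by an arc $m\to r$ and a pole at $s$; - (C) replace arcs $m\to r$, $n\to s$ by arcs $m\to n$, $r\to s$; - (D) replace an arc $m\to s$ and a pole at $r$ by an arc $r\to s$ and a pole at $m$ (in (B) and (D) only $m>r>s$ is involved). For $Y,Z\in\mathcal S_2(k)$ write $Y\le_{\rm arc}Z$ if $\Delta(Y)\le_{\rm arc}\Delta(Z)$. Write $Y\le_{\rm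 ext}Z$ if for some natural number $s$ there are objects $M_i$ and short exact sequences $0\to U_i\to M_i\to V_i\to0$ in $\mathcal S(k)$ with $Y\cong M_1$, $U_i\oplus V_i\cong M_{i+1}$ for $1\le i\le s$, and $Z\cong M_{s+1}$. **Lemma.** If $Y,Z\in\mathcal S_2(k)$ have the same partition type $(\alpha,\beta,\gamma)$ and $Y\le_{\rm arc}Z$, then $Y\le_{\rm ext}Z$. Moreover, for all integers $m>n>r>s\ge1$ (respectively $m>r>s\ge 1$ in (B) and (D)), there are short exact sequences in $\mathcal S(k)$ - (A), $n>r+1$: $0\to B_2^{n,s}\to B_2^{m,s}\oplus B_2^{n,r}\to B_2^{m,r}\to0$; - (A$'$), $n=r+1$: $0\to B_2^{n,s}\to B_2^{m,s}\oplus P_2^n\oplus P_0^r\to B_2^{m,r}\to0$; - (B): $0\to B_2^{m,s}\to B_2^{m,r}\oplus P_1^s\to P_1^r\to0$; - (C): $0\to B_2^{m,r}\to B_2^{m,n}\oplus B_2^{r,s}\to B_2^{n,s}\to0$; - (D): $0\to P_1^r\to P_1^m\oplus B_2^{r,s}\to B_2^{m,s}\to0$; and in each of them the arc diagram of the middle term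 is obtained from the arc diagram of the direct sum of the end terms by the move named. -/

import Mathlib

open Polynomial

universe u

/-! ## Nilpotent operators and embeddings -/

/-- The nilpotent Jordan block `N_(m) = k[T]/(T^m)`, as a `k[T]`-module. -/
abbrev JordanBlock (k : Type u) [Field k] (m : ℕ) : Type u :=
  k[X] ⧸ Ideal.span {(X : k[X]) ^ m}

/-- The nilpotent operator `N_α = ⨁ k[T]/(T^(α_i))` given by the partition `α`. -/
abbrev NilpotentOperator (k : Type u) [Field k] {n : ℕ} (α : n.Partition) : Type u :=
  (i : α.parts.ToType) → JordanBlock k i.1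

/-- An object of `S(k)`: a monomorphism of `k[T]`-modules whose target is a nilpotent linear
operator on a finite dimensional vector space, i.e. a finitely generated `k[T]`-module which is
annihilated by a power of `T` (the source then has the same properties). -/
structure InvSubspace (k : Type u) [Field k] : Type (u + 1) where
  sub : Type u
  amb : Type u
  [subGroup : AddCommGroup sub]
  [ambGroup : AddCommGroup amb]
  [subModule : Module k[X] sub]
  [ambModule : Module k[X] amb]
  incl : sub →ₗ[k[X]] amb
  incl_injective : Function.Injective incl
  finite_amb : Module.Finite k[X] amb
  nilpotent_amb : ∃ n : ℕ, ∀ x : amb, (X : k[X]) ^ n • x = 0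

attribute [instance] InvSubspace.subGroup InvSubspace.ambGroup InvSubspace.subModule
  InvSubspace.ambModule

namespace InvSubspace

variable {k : Type u} [Field k]

/-- `Y` is an object of `S_n(k)`: the operator acts on the subspace with nilpotency index at
most `n`. -/
def InS (n : ℕ) (Y : InvSubspace k) : Prop :=
  ∀ x : Y.sub, (X : k[X]) ^ n • x = 0

/-- `Y` has partition type `(α, β, γ)`: there are isomorphisms of `k[T]`-modules of the subspace
with `N_α`, of the ambient space with `N_β` and of the cokernel with `N_γ`. -/
def HasType {a b c : ℕ} (Y : InvSubspace k) (α : a.Partition) (β : b.Partition)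
    (γ : c.Partition) : Prop :=
  Nonempty (Y.sub ≃ₗ[k[X]] NilpotentOperator k α) ∧
  Nonempty (Y.amb ≃ₗ[k[X]] NilpotentOperator k β) ∧
  Nonempty ((Y.amb ⧸ LinearMap.range Y.incl) ≃ₗ[k[X]] NilpotentOperator k γ)

/-- A morphism in `S(k)`. -/
structure Hom (Y Z : InvSubspace k) where
  onSub : Y.sub →ₗ[k[X]] Z.sub
  onAmb : Y.amb →ₗ[k[X]] Z.amb
  comm : ∀ x : Y.sub, Z.incl (onSub x) = onAmb (Y.incl x)

/-- `Y` and `Z` are isomorphic in `S(k)`. -/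
def IsIso (Y Z : InvSubspace k) : Prop :=
  ∃ f : Hom Y Z, Function.Bijective f.onSub ∧ Function.Bijective f.onAmb

/-- There is a short exact sequence `0 → U → M → V → 0` in `S(k)`. -/
def IsExtension (U M V : InvSubspace k) : Prop :=
  ∃ (f : Hom U M) (g : Hom M V),
    Function.Injective f.onSub ∧ Function.Injective f.onAmb ∧
    Function.Exact f.onSub g.onSub ∧ Function.Exact f.onAmb g.onAmb ∧
    Function.Surjective g.onSub ∧ Function.Surjective g.onAmb

/-- The zero object. -/
noncomputable def zero (k : Type u) [Field k] : InvSubspace k where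
  sub := PUnit
  amb := PUnit
  incl := 0
  incl_injective := fun _ _ _ => rfl
  finite_amb := inferInstance
  nilpotent_amb := ⟨0, fun _ => rfl⟩

/-- The direct sum of two objects. -/
noncomputable def dsum (Y Z : InvSubspace k) : InvSubspace k where
  sub := Y.sub × Z.sub
  amb := Y.amb × Z.amb
  incl := Y.incl.prodMap Z.incl
  incl_injective := Y.incl_injective.prodMap Z.incl_injective
  finite_amb := by
    have := Y.finite_amb
    have := Z.finite_amb
    infer_instance
  nilpotent_amb := by
    obtain ⟨p, hp⟩ := Y.nilpotent_amb
    obtain ⟨q, hq⟩ := Z.nilpotent_amb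
    refine ⟨p + q, fun x => Prod.ext ?_ ?_⟩
    · change (X : k[X]) ^ (p + q) • x.1 = 0
      rw [add_comm, pow_add, mul_smul, hp, smul_zero]
    · change (X : k[X]) ^ (p + q) • x.2 = 0
      rw [pow_add, mul_smul, hq, smul_zero]

/-- The relation `Y ≤_ext Z`. -/
def ExtLE (Y Z : InvSubspace k) : Prop :=
  ∃ (s : ℕ) (M U V : ℕ → InvSubspace k),
    IsIso Y (M 1) ∧
    (∀ i, 1 ≤ i → i ≤ s →
      IsExtension (U i) (M i) (V i) ∧ IsIso (dsum (U i) (V i)) (M (i + 1))) ∧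
    IsIso Z (M (s + 1))

end InvSubspace

/-! ## Pickets and bipickets -/

namespace JordanBlock

variable (k : Type u) [Field k]

/-- Multiplication by `T^c` as a map `k[T]/(T^a) → k[T]/(T^b)`, where `b ≤ a + c`. -/
noncomputable def mulPow (a b c : ℕ) (h : b ≤ a + c) :
    JordanBlock k a →ₗ[k[X]] JordanBlock k b :=
  Submodule.mapQ _ _ (LinearMap.mulLeft k[X] ((X : k[X]) ^ c)) (by
    rw [Ideal.span, Submodule.span_le]
    rintro _ rfl
    refine Ideal.mem_span_singleton.2 ?_
    simpa [← pow_add, add_comm] using pow_dvd_pow (X : k[X]) h)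

theorem mulPow_injective (a c : ℕ) : Function.Injective (mulPow k a (a + c) c le_rfl) := by
  rw [← LinearMap.ker_eq_bot, LinearMap.ker_eq_bot']
  intro x
  induction x using Submodule.Quotient.induction_on with
  | _ p =>
    intro hp
    rw [mulPow, Submodule.mapQ_apply, Submodule.Quotient.mk_eq_zero] at hp
    have hp' := Ideal.mem_span_singleton.1 hp
    rw [LinearMap.mulLeft_apply, pow_add, mul_comm (X ^ a)] at hp'
    rw [Submodule.Quotient.mk_eq_zero]
    exact Ideal.mem_span_singleton.2
      ((mul_dvd_mul_iff_left (pow_ne_zero c Polynomial.X_ne_zero)).1 hp')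

theorem mulPow_injective' (a b : ℕ) (h : a ≤ b) (h' : b ≤ a + (b - a)) :
    Function.Injective (mulPow k a b (b - a) h') := by
  obtain ⟨c, rfl⟩ := Nat.exists_eq_add_of_le h
  have hc : a + c - a = c := by omega
  simp only [hc]
  exact mulPow_injective k a c

theorem pow_smul (m : ℕ) (x : JordanBlock k m) : (X : k[X]) ^ m • x = 0 := by
  induction x using Submodule.Quotient.induction_on with
  | _ p =>
    rw [← Submodule.Quotient.mk_smul, Submodule.Quotient.mk_eq_zero, smul_eq_mul]
    exact Ideal.mul_mem_right _ _ (Ideal.mem_span_singleton_self _)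

end JordanBlock

/-- The picket `P_ℓ^m = (N_(ℓ), N_(m), ι)`, where `ι(1) = T^(m-ℓ)`. -/
noncomputable def picket (k : Type u) [Field k] (l m : ℕ) (h : l ≤ m) : InvSubspace k where
  sub := JordanBlock k l
  amb := JordanBlock k m
  incl := JordanBlock.mulPow k l m (m - l) (by omega)
  incl_injective := JordanBlock.mulPow_injective' k l m h _
  finite_amb := inferInstance
  nilpotent_amb := ⟨m, JordanBlock.pow_smul k m⟩

/-- The bipicket `B_2^{m,r} = (N_(2), N_(m,r), δ)`, where `δ(1) = (T^(m-2), T^(r-1))` and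
`1 ≤ r ≤ m - 2`. -/
noncomputable def bipicket (k : Type u) [Field k] (m r : ℕ) (hr : 1 ≤ r) (h : r + 2 ≤ m) :
    InvSubspace k where
  sub := JordanBlock k 2
  amb := JordanBlock k m × JordanBlock k r
  incl := (JordanBlock.mulPow k 2 m (m - 2) (by omega)).prod
    (JordanBlock.mulPow k 2 r (r - 1) (by omega))
  incl_injective := fun _ _ hxy =>
    JordanBlock.mulPow_injective' k 2 m (by omega) (by omega) (congrArg Prod.fst hxy)
  finite_amb := inferInstance
  nilpotent_amb := by
    refine ⟨m, fun x => Prod.ext (JordanBlock.pow_smul k m x.1) ?_⟩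
    change (X : k[X]) ^ m • x.2 = 0
    obtain ⟨c, rfl⟩ : ∃ c, m = c + r := ⟨m - r, by omega⟩
    rw [pow_add, mul_smul, JordanBlock.pow_smul, smul_zero]

/-- `B_2^{m,r}` for `1 ≤ r ≤ m - 1`, with the convention `B_2^{m,m-1} = P_2^m ⊕ P_0^{m-1}`. -/
noncomputable def extBipicket (k : Type u) [Field k] (m r : ℕ) (hr : 1 ≤ r) (h : r < m) :
    InvSubspace k :=
  if h' : r + 2 ≤ m then bipicket k m r hr h'
  else (picket k 2 m (by omega)).dsum (picket k 0 r (Nat.zero_le r))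

/-- Labels for the indecomposable objects of `S_2(k)`: the pickets `P_ℓ^m` where `ℓ ≤ min{2, m}`
and `m ≥ 1`, and the bipickets `B_2^{m,r}` where `1 ≤ r ≤ m - 2`. -/
inductive Indec : Type
  | P (l m : ℕ) (hl : l ≤ 2) (hlm : l ≤ m) (hm : 1 ≤ m)
  | B (m r : ℕ) (hr : 1 ≤ r) (h : r + 2 ≤ m)

/-- The indecomposable object with a given label. -/
noncomputable def Indec.obj (k : Type u) [Field k] : Indec → InvSubspace k
  | .P l m _ hlm _ => picket k l m hlm
  | .B m r hr h => bipicket k m r hr h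

/-- The direct sum of a finite list of indecomposable objects. -/
noncomputable def sumObj (k : Type u) [Field k] : List Indec → InvSubspace k
  | [] => InvSubspace.zero k
  | x :: l => (x.obj k).dsum (sumObj k l)

/-! ## Tableaux and arc diagrams -/

/-- The data of a Klein tableau with entries at most `2`.  Since the rows are ordered, the tableau
is determined by the lengths of its columns (the partition `β`), by the rows of its entries `1`
(with multiplicity), and by the pairs `(m, r)`, one for each symbol `2_r` in row `m`; all
other boxes, the boxes of `γ`, are empty.  Only the tableaux of objects in `S_2(k)` are used. -/
@[ext] structure KleinTableau where
  cols : Multiset ℕ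
  ones : Multiset ℕ
  twos : Multiset (ℕ × ℕ)

namespace KleinTableau

/-- The empty tableau. -/
def empty : KleinTableau := ⟨0, 0, 0⟩

/-- The tableau of a direct sum: columns are united, and in each row the entries are united. -/
def union (P Q : KleinTableau) : KleinTableau :=
  ⟨P.cols + Q.cols, P.ones + Q.ones, P.twos + Q.twos⟩

/-- The tableau of an indecomposable object.  For `P_ℓ^m` it has one column of `m` boxes, the `ℓ`
boxes at the bottom having entries `1, …, ℓ`, with subscript `m - 1` in the case of an entry `2`;
for `B_2^{m,r}` it has two columns of `m` and `r` boxes with `2_r` and `1` at the bottom. -/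
def ofIndec : Indec → KleinTableau
  | .P 0 m _ _ _ => ⟨{m}, 0, 0⟩
  | .P 1 m _ _ _ => ⟨{m}, {m}, 0⟩
  | .P _ m _ _ _ => ⟨{m}, {m - 1}, {(m, m - 1)}⟩
  | .B m r _ _ => ⟨{m, r}, {r}, {(m, r)}⟩

/-- The tableau of a finite direct sum of indecomposable objects. -/
def ofList : List Indec → KleinTableau
  | [] => empty
  | x :: l => union (ofIndec x) (ofList l)

end KleinTableau

/-- `P` is the Klein tableau of the object `Y`: it is the tableau of a direct sum of pickets and
bipickets which is isomorphic to `Y`. -/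
def InvSubspace.HasKleinTableau {k : Type u} [Field k] (Y : InvSubspace k) (P : KleinTableau) : Prop :=
  ∃ l : List Indec, Y.IsIso (sumObj k l) ∧ P = KleinTableau.ofList l

/-- An arc diagram: a finite multiset of arcs, an arc from `m` to `r < m` being given by the pair
`(m, r)`, and a finite multiset of poles, given by their vertices. -/
@[ext] structure ArcDiagram where
  arcs : Multiset (ℕ × ℕ)
  poles : Multiset ℕ

namespace ArcDiagram

/-- Superposition of arc diagrams. -/
instance : Add ArcDiagram := ⟨fun D E => ⟨D.arcs + E.arcs, D.poles + E.poles⟩⟩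

/-- `Move D E`: the arc diagram `D` is obtained from `E` by a single move of type (A), (B), (C)
or (D).  The arcs and poles in `D₀` are those not affected by the move. -/
inductive Move : ArcDiagram → ArcDiagram → Prop
  | A (D₀ : ArcDiagram) (m n r s : ℕ) (hnm : n < m) (hrn : r < n) (hsr : s < r) :
      Move (D₀ + ⟨{(m, s), (n, r)}, 0⟩) (D₀ + ⟨{(m, r), (n, s)}, 0⟩)
  | B (D₀ : ArcDiagram) (m r s : ℕ) (hrm : r < m) (hsr : s < r) :
      Move (D₀ + ⟨{(m, r)}, {s}⟩) (D₀ + ⟨{(m, s)}, {r}⟩)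
  | C (D₀ : ArcDiagram) (m n r s : ℕ) (hnm : n < m) (hrn : r < n) (hsr : s < r) :
      Move (D₀ + ⟨{(m, n), (r, s)}, 0⟩) (D₀ + ⟨{(m, r), (n, s)}, 0⟩)
  | D (D₀ : ArcDiagram) (m r s : ℕ) (hrm : r < m) (hsr : s < r) :
      Move (D₀ + ⟨{(r, s)}, {m}⟩) (D₀ + ⟨{(m, s)}, {r}⟩)

/-- The arc order on arc diagrams: the first is obtained from the second by a finite sequence of
moves. -/
def ArcLE : ArcDiagram → ArcDiagram → Prop :=
  Relation.ReflTransGen Move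

end ArcDiagram

/-- The arc diagram of a Klein tableau: an arc from `m` to `r` for each symbol `2_r` in row `m`,
and poles at `r`, one for each entry `1` in row `r` in excess of the number of arcs ending
at `r`. -/
def KleinTableau.arcDiagram (P : KleinTableau) : ArcDiagram :=
  ⟨P.twos, P.ones - P.twos.map Prod.snd⟩

namespace InvSubspace

variable {k : Type u} [Field k]

/-- `D` is the arc diagram of the object `Y`. -/
def HasArcDiagram (Y : InvSubspace k) (D : ArcDiagram) : Prop :=
  ∃ P : KleinTableau, Y.HasKleinTableau P ∧ P.arcDiagram = D

/-- The relation `Y ≤_arc Z` for objects of `S_2(k)`. -/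
def ArcLE (Y Z : InvSubspace k) : Prop :=
  ∃ D E : ArcDiagram, Y.HasArcDiagram D ∧ Z.HasArcDiagram E ∧ D.ArcLE E

/-- There is a short exact sequence `0 → U → M → V → 0` in `S(k)` which witnesses the replacement
of the arcs and poles `E` by the arcs and poles `D`: the middle term has arc diagram `D`, the
direct sum of the end terms has arc diagram `E`. -/
def Witnesses (U M V : InvSubspace k) (D E : ArcDiagram) : Prop :=
  IsExtension U M V ∧ M.HasArcDiagram D ∧ (dsum U V).HasArcDiagram E

end InvSubspace

/-! The heart of the matter is local: every move is realised by one short exact sequence. On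
subspaces it is always the graph sequence `x ↦ (x, t x)`, `(x, y) ↦ t x - y`. On ambient spaces the
middle term and the end terms have the same Jordan blocks, and the maps are identities, up to sign,
corrected by inclusions of a smaller block into a larger one (`embeddingsExact_moveA` to
`embeddingsExact_moveD`). The convention for `B_2^{m,m-1}` needs no separate treatment, because the
formula defining bipickets still makes sense for `r = m - 1` and gives `P_2^m ⊕ P_0^{m-1}` up to
isomorphism (`linkedPair_isIso_extBipicket`).

To pass from local to global, note that an arc diagram forgets exactly the summands `P_0^m`, and
that these are recovered from the column lengths. So arc diagram and columns together determine the
list of summands (`perm_of_arcDiagram_eq`). The columns are the Jordan type of the ambient space,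
hence agree for `Y` and `Z` (`cols_eq_of_amb_equiv`), and moves preserve them.

Every arc removed by a move passes over an intermediate vertex, so it belongs to a genuine bipicket,
which is visible in the diagram. Starting from `Z`, each move therefore replaces actual summands by
the middle term of an exact sequence (`exists_list_of_move`), and the chain ends at an object with
the columns and the arc diagram of `Y`. -/

open InvSubspace JordanBlock Indec KleinTableau

/-! ### Multiplication maps between Jordan blocks -/

namespace JordanBlock

variable {k : Type u} [Field k]

theorem mulPow_mk (a b c : ℕ) (h : b ≤ a + c) (p : k[X]) :
    mulPow k a b c h (Submodule.Quotient.mk p) = Submodule.Quotient.mk (X ^ c * p) := rfl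

theorem mulPow_mulPow {a b d i j : ℕ} (h : b ≤ a + i) (h' : d ≤ b + j) (x : JordanBlock k a) :
    mulPow k b d j h' (mulPow k a b i h x) = mulPow k a d (i + j) (by omega) x := by
  induction x using Submodule.Quotient.induction_on with
  | _ p => simp only [mulPow_mk]; rw [pow_add, ← mul_assoc, mul_comm (X ^ j)]

/-- Reduces each commutative square of multiplication maps to an identity between exponents, which
`omega` settles at the point of use. -/
theorem mulPow_mulPow_of_eq {a b d i j c : ℕ} (x : JordanBlock k a) (hc : i + j = c := by omega)
    (h : b ≤ a + i := by omega) (h' : d ≤ b + j := by omega) (h'' : d ≤ a + c := by omega) :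
    mulPow k b d j h' (mulPow k a b i h x) = mulPow k a d c h'' x := by
  subst hc; exact mulPow_mulPow h h' x

theorem mulPow_eq_zero {a b c : ℕ} (h : b ≤ a + c) (hc : b ≤ c) (x : JordanBlock k a) :
    mulPow k a b c h x = 0 := by
  induction x using Submodule.Quotient.induction_on with
  | _ p =>
    rw [mulPow_mk, Submodule.Quotient.mk_eq_zero]
    exact Ideal.mem_span_singleton.2 ((pow_dvd_pow X hc).mul_right p)

instance subsingleton_zero : Subsingleton (JordanBlock k 0) := by
  rw [Submodule.Quotient.subsingleton_iff, pow_zero]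
  exact Ideal.span_singleton_one

theorem length_eq (m : ℕ) : Module.length k[X] (JordanBlock k m) = m := by
  have h := Ring.ord_pow (R := k[X]) (mem_nonZeroDivisors_of_ne_zero X_ne_zero) m
  rw [Ring.ord_of_irreducible irreducible_X] at h
  simpa [Ring.ord] using h

end JordanBlock

/-! ### Jordan type from the lengths of the images of powers of `T` -/

/-- The length of the image of multiplication by `T^j`. -/
noncomputable def powLength (k : Type u) [Field k] (M : Type*) [AddCommGroup M] [Module k[X] M]
    (j : ℕ) : ℕ∞ :=
  Module.length k[X] (LinearMap.range (LinearMap.lsmul k[X] M (X ^ j)))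

section powLength

variable {k : Type u} [Field k] {M N L : Type*} [AddCommGroup M] [Module k[X] M]
  [AddCommGroup N] [Module k[X] N] [AddCommGroup L] [Module k[X] L]

theorem powLength_eq {j : ℕ} (f : L →ₗ[k[X]] M) (hf : Function.Injective f)
    (h : ∀ y, (∃ z, f z = y) ↔ ∃ x, (X : k[X]) ^ j • x = y) :
    powLength k M j = Module.length k[X] L := by
  have : LinearMap.range (LinearMap.lsmul k[X] M (X ^ j)) = LinearMap.range f := by
    ext y; exact (h y).symm
  rw [powLength, this]
  exact (LinearEquiv.ofInjective f hf).length_eq.symm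

theorem powLength_congr (e : M ≃ₗ[k[X]] N) (j : ℕ) : powLength k M j = powLength k N j := by
  refine (powLength_eq (e.toLinearMap ∘ₗ Submodule.subtype _)
    (e.injective.comp (Submodule.subtype_injective _)) fun y => ⟨?_, ?_⟩).symm
  · rintro ⟨⟨_, x, rfl⟩, rfl⟩
    exact ⟨e x, by simp⟩
  · rintro ⟨x, rfl⟩
    exact ⟨⟨_, e.symm x, rfl⟩, by simp⟩

theorem powLength_prod (j : ℕ) :
    powLength k (M × N) j = powLength k M j + powLength k N j := by
  rw [powLength, powLength, powLength, ← Module.length_prod]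
  refine powLength_eq ((Submodule.subtype _).prodMap (Submodule.subtype _))
    ((Submodule.subtype_injective _).prodMap (Submodule.subtype_injective _)) fun y => ⟨?_, ?_⟩
  · rintro ⟨⟨⟨_, x, rfl⟩, ⟨_, x', rfl⟩⟩, rfl⟩
    exact ⟨(x, x'), rfl⟩
  · rintro ⟨x, rfl⟩
    exact ⟨(⟨_, x.1, rfl⟩, ⟨_, x.2, rfl⟩), rfl⟩

theorem powLength_of_subsingleton [Subsingleton M] (j : ℕ) : powLength k M j = 0 :=
  Module.length_eq_zero

theorem powLength_jordanBlock (m j : ℕ) : powLength k (JordanBlock k m) j = (m - j : ℕ) := by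
  rw [← JordanBlock.length_eq (k := k)]
  -- With truncated subtraction this covers both cases: if `j ≤ m` the exponent `m - (m - j)` is
  -- `j`, otherwise the source is the zero block.
  refine powLength_eq (JordanBlock.mulPow k (m - j) m (m - (m - j)) (by omega))
    (JordanBlock.mulPow_injective' k _ _ (by omega) _) fun y => ?_
  rcases le_total m j with h | h
  · have hz : ∀ x : JordanBlock k m, (X : k[X]) ^ j • x = 0 := fun x => by
      obtain ⟨c, rfl⟩ := Nat.exists_eq_add_of_le h
      rw [pow_add, mul_comm, mul_smul, JordanBlock.pow_smul, smul_zero]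
    constructor
    · rintro ⟨z, rfl⟩
      exact ⟨0, by rw [hz, JordanBlock.mulPow_eq_zero _ (by omega)]⟩
    · rintro ⟨x, rfl⟩
      exact ⟨0, by rw [hz, map_zero]⟩
  · have hj : m - (m - j) = j := by omega
    constructor
    · rintro ⟨z, rfl⟩
      induction z using Submodule.Quotient.induction_on with
      | _ p =>
        refine ⟨Submodule.Quotient.mk p, ?_⟩
        rw [JordanBlock.mulPow_mk, hj]; rfl
    · rintro ⟨x, rfl⟩
      induction x using Submodule.Quotient.induction_on with
      | _ p =>
        refine ⟨Submodule.Quotient.mk p, ?_⟩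
        rw [JordanBlock.mulPow_mk, hj]; rfl

end powLength

/-- The second difference of `j ↦ max (a - j, 0)` is `1` at `j = a` and `0` at the other positive
`j`. -/
theorem Multiset.sum_map_tsub_add_sum_map_tsub (S : Multiset ℕ) (c : ℕ) :
    (S.map (· - c)).sum + (S.map (· - (c + 2))).sum =
      2 * (S.map (· - (c + 1))).sum + S.count (c + 1) := by
  induction S using Multiset.induction_on with
  | empty => simp
  | cons a S ih =>
    simp only [Multiset.map_cons, Multiset.sum_cons, Multiset.count_cons]
    split_ifs <;> omega

/-- Second differences recover all positive multiplicities; the sums do not see zeros, which have to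
be excluded. -/
theorem Multiset.eq_of_sum_map_tsub_eq {S S' : Multiset ℕ} (h0 : 0 ∉ S) (h0' : 0 ∉ S')
    (h : ∀ j, (S.map (· - j)).sum = (S'.map (· - j)).sum) : S = S' := by
  ext c
  cases c with
  | zero => rw [Multiset.count_eq_zero_of_notMem h0, Multiset.count_eq_zero_of_notMem h0']
  | succ c =>
    have h1 := S.sum_map_tsub_add_sum_map_tsub c
    have h2 := S'.sum_map_tsub_add_sum_map_tsub c
    rw [h, h, h] at h1
    omega

/-! ### Isomorphisms, extensions and the ext order -/

namespace InvSubspace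

variable {k : Type u} [Field k]

theorem IsIso.of_equiv {Y Z : InvSubspace k} (e : Y.sub ≃ₗ[k[X]] Z.sub)
    (e' : Y.amb ≃ₗ[k[X]] Z.amb) (h : ∀ x, Z.incl (e x) = e' (Y.incl x)) : Y.IsIso Z :=
  ⟨⟨e, e', h⟩, e.bijective, e'.bijective⟩

theorem IsIso.exists_equiv {Y Z : InvSubspace k} (h : Y.IsIso Z) :
    ∃ (e : Y.sub ≃ₗ[k[X]] Z.sub) (e' : Y.amb ≃ₗ[k[X]] Z.amb),
      ∀ x, Z.incl (e x) = e' (Y.incl x) := by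
  obtain ⟨f, h1, h2⟩ := h
  exact ⟨.ofBijective f.onSub h1, .ofBijective f.onAmb h2, f.comm⟩

theorem IsIso.refl (Y : InvSubspace k) : Y.IsIso Y :=
  .of_equiv (.refl _ _) (.refl _ _) fun _ => rfl

theorem IsIso.symm {Y Z : InvSubspace k} (h : Y.IsIso Z) : Z.IsIso Y := by
  obtain ⟨e, e', h⟩ := h.exists_equiv
  refine .of_equiv e.symm e'.symm fun x => ?_
  rw [LinearEquiv.eq_symm_apply, ← h, LinearEquiv.apply_symm_apply]

theorem IsIso.trans {W Y Z : InvSubspace k} (h : W.IsIso Y) (h' : Y.IsIso Z) : W.IsIso Z := by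
  obtain ⟨e, e', h⟩ := h.exists_equiv
  obtain ⟨f, f', h'⟩ := h'.exists_equiv
  exact .of_equiv (e.trans f) (e'.trans f') fun x => by simp [h, h']

theorem IsIso.dsum_congr {Y Y' Z Z' : InvSubspace k} (h : Y.IsIso Y') (h' : Z.IsIso Z') :
    (Y.dsum Z).IsIso (Y'.dsum Z') := by
  obtain ⟨e, e', h⟩ := h.exists_equiv
  obtain ⟨f, f', h'⟩ := h'.exists_equiv
  exact .of_equiv (Y := Y.dsum Z) (Z := Y'.dsum Z') (e.prodCongr f) (e'.prodCongr f')
    fun x => Prod.ext (h x.1) (h' x.2)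

theorem IsIso.dsum_comm (Y Z : InvSubspace k) : (Y.dsum Z).IsIso (Z.dsum Y) :=
  .of_equiv (Y := Y.dsum Z) (Z := Z.dsum Y) (.prodComm _ _ _) (.prodComm _ _ _) fun _ => rfl

theorem IsIso.dsum_assoc (W Y Z : InvSubspace k) :
    ((W.dsum Y).dsum Z).IsIso (W.dsum (Y.dsum Z)) :=
  .of_equiv (Y := (W.dsum Y).dsum Z) (Z := W.dsum (Y.dsum Z))
    (.prodAssoc _ _ _ _) (.prodAssoc _ _ _ _) fun _ => rfl

theorem IsIso.dsum_zero (Y : InvSubspace k) : (Y.dsum (zero k)).IsIso Y :=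
  .of_equiv (Y := Y.dsum (zero k)) (Z := Y)
    (show (Y.sub × PUnit.{u + 1}) ≃ₗ[k[X]] Y.sub from LinearEquiv.prodUnique)
    (show (Y.amb × PUnit.{u + 1}) ≃ₗ[k[X]] Y.amb from LinearEquiv.prodUnique) fun _ => rfl

theorem IsIso.zero_dsum (Y : InvSubspace k) : ((zero k).dsum Y).IsIso Y :=
  (dsum_comm _ _).trans (dsum_zero _)

theorem IsExtension.congr_middle {U M M' V : InvSubspace k} (h : IsExtension U M V)
    (hM : M.IsIso M') : IsExtension U M' V := by
  obtain ⟨e, e', he⟩ := hM.exists_equiv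
  obtain ⟨f, g, h1, h2, h3, h4, h5, h6⟩ := h
  refine ⟨⟨e.toLinearMap ∘ₗ f.onSub, e'.toLinearMap ∘ₗ f.onAmb, fun x => ?_⟩,
    ⟨g.onSub ∘ₗ e.symm.toLinearMap, g.onAmb ∘ₗ e'.symm.toLinearMap, fun x => ?_⟩,
    e.injective.comp h1, e'.injective.comp h2, ?_, ?_,
    h5.comp e.symm.surjective, h6.comp e'.symm.surjective⟩
  · simp [he, f.comm]
  · obtain ⟨x, rfl⟩ := e.surjective x
    simp [he, g.comm]
  · intro x
    obtain ⟨x, rfl⟩ := e.surjective x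
    simpa using h3 x
  · intro x
    obtain ⟨x, rfl⟩ := e'.surjective x
    simpa using h4 x

/-- Adds the sequence `0 → 0 → W → W → 0`; it carries along the summands that a move does not touch.
-/
theorem IsExtension.dsum_right {U M V : InvSubspace k} (h : IsExtension U M V)
    (W : InvSubspace k) : IsExtension U (M.dsum W) (V.dsum W) := by
  obtain ⟨f, g, h1, h2, h3, h4, h5, h6⟩ := h
  refine ⟨⟨f.onSub.prod 0, f.onAmb.prod 0, fun x => Prod.ext (f.comm x) (map_zero W.incl)⟩,
    ⟨g.onSub.prodMap LinearMap.id, g.onAmb.prodMap LinearMap.id,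
      fun x => Prod.ext (g.comm x.1) rfl⟩,
    fun x y hxy => h1 (congrArg Prod.fst hxy), fun x y hxy => h2 (congrArg Prod.fst hxy), ?_, ?_,
    h5.prodMap Function.surjective_id, h6.prodMap Function.surjective_id⟩
  · rintro ⟨x, w⟩
    refine Prod.ext_iff.trans ⟨?_, ?_⟩
    · rintro ⟨hx, hw⟩
      obtain ⟨y, rfl⟩ := (h3 x).1 hx
      exact ⟨y, Prod.ext rfl (Eq.symm hw)⟩
    · rintro ⟨y, hy⟩
      exact ⟨(h3 x).2 ⟨y, congrArg Prod.fst hy⟩, (congrArg Prod.snd hy).symm⟩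
  · rintro ⟨x, w⟩
    refine Prod.ext_iff.trans ⟨?_, ?_⟩
    · rintro ⟨hx, hw⟩
      obtain ⟨y, rfl⟩ := (h4 x).1 hx
      exact ⟨y, Prod.ext rfl (Eq.symm hw)⟩
    · rintro ⟨y, hy⟩
      exact ⟨(h4 x).2 ⟨y, congrArg Prod.fst hy⟩, (congrArg Prod.snd hy).symm⟩

theorem ExtLE.of_isIso {Y Z : InvSubspace k} (h : Y.IsIso Z) : Y.ExtLE Z :=
  ⟨0, fun _ => Z, fun _ => Z, fun _ => Z, h, fun _ h1 h2 => by omega, .refl Z⟩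

theorem ExtLE.congr_left {Y Y' Z : InvSubspace k} (h : Y.ExtLE Z) (hY : Y'.IsIso Y) :
    Y'.ExtLE Z := by
  obtain ⟨s, M, U, V, h1, h2, h3⟩ := h
  exact ⟨s, M, U, V, hY.trans h1, h2, h3⟩

theorem ExtLE.congr_right {Y Z Z' : InvSubspace k} (h : Y.ExtLE Z) (hZ : Z'.IsIso Z) :
    Y.ExtLE Z' := by
  obtain ⟨s, M, U, V, h1, h2, h3⟩ := h
  exact ⟨s, M, U, V, h1, h2, hZ.trans h3⟩

theorem ExtLE.trans_isExtension {Y U M V : InvSubspace k} (h : Y.ExtLE M)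
    (hM : IsExtension U M V) : Y.ExtLE (U.dsum V) := by
  obtain ⟨s, M', U', V', h1, h2, h3⟩ := h
  -- The old chain ends at `M' (s + 1) ≅ M`, which becomes the middle term of the new sequence; `U ⊕
  -- V` is placed at index `s + 2`.
  refine ⟨s + 1, fun i => if i = s + 2 then U.dsum V else M' i,
    fun i => if i = s + 1 then U else U' i, fun i => if i = s + 1 then V else V' i, ?_, ?_, ?_⟩
  · simpa using h1
  · intro i hi hi'
    rcases Nat.lt_or_ge s i with hs | hs
    · obtain rfl : i = s + 1 := by omega
      simpa using ⟨hM.congr_middle h3, IsIso.refl _⟩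
    · simpa [show i ≠ s + 1 by omega, show i ≠ s + 2 by omega] using h2 i hi hs
  · simpa using IsIso.refl _

end InvSubspace

/-! ### Direct sums over lists of indecomposables, and their columns -/

section sumObj

variable (k : Type u) [Field k]

theorem sumObj_append (l l' : List Indec) :
    (sumObj k (l ++ l')).IsIso ((sumObj k l).dsum (sumObj k l')) := by
  induction l with
  | nil => exact (IsIso.zero_dsum _).symm
  | cons x l ih => exact ((IsIso.refl _).dsum_congr ih).trans (IsIso.dsum_assoc _ _ _).symm

theorem sumObj_perm {l l' : List Indec} (h : l.Perm l') : (sumObj k l).IsIso (sumObj k l') := by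
  induction h with
  | nil => exact .refl _
  | cons x _ ih => exact (IsIso.refl _).dsum_congr ih
  | swap x y l =>
    exact ((IsIso.dsum_assoc _ _ _).symm.trans
      ((IsIso.dsum_comm _ _).dsum_congr (.refl _))).trans (IsIso.dsum_assoc _ _ _)
  | trans _ _ ih ih' => exact ih.trans ih'

theorem sumObj_singleton (x : Indec) : (sumObj k [x]).IsIso (x.obj k) := .dsum_zero _

theorem sumObj_pair (x y : Indec) : (sumObj k [x, y]).IsIso ((x.obj k).dsum (y.obj k)) :=
  (IsIso.refl _).dsum_congr (sumObj_singleton k y)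

end sumObj

namespace KleinTableau

theorem ofList_append (l l' : List Indec) :
    ofList (l ++ l') = union (ofList l) (ofList l') := by
  induction l with
  | nil => simp [ofList, union, empty]
  | cons x l ih => simp [ofList, ih, union, add_assoc]

theorem zero_notMem_cols (l : List Indec) : 0 ∉ (ofList l).cols := by
  induction l with
  | nil => simp [ofList, empty]
  | cons x l ih =>
    rcases x with ⟨_ | _ | _, m, hl, hlm, hm⟩ | ⟨m, r, hr, h⟩ <;>
      simp [ofList, union, ofIndec, ih] <;> omega

end KleinTableau

section cols

variable {k : Type u} [Field k]

theorem powLength_amb_sumObj (l : List Indec) (j : ℕ) :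
    powLength k (sumObj k l).amb j = (((KleinTableau.ofList l).cols.map (· - j)).sum : ℕ) := by
  induction l with
  | nil => exact powLength_of_subsingleton (M := PUnit) j
  | cons x l ih =>
    refine (powLength_prod (M := (x.obj k).amb) j).trans ?_
    rw [ih]
    rcases x with ⟨_ | _ | _, m, hl, hlm, hm⟩ | ⟨m, r, hr, h⟩
    · refine (congrArg (· + _) (powLength_jordanBlock m j)).trans ?_
      simp [KleinTableau.ofList, KleinTableau.union, KleinTableau.ofIndec]
    · refine (congrArg (· + _) (powLength_jordanBlock m j)).trans ?_
      simp [KleinTableau.ofList, KleinTableau.union, KleinTableau.ofIndec]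
    · refine (congrArg (· + _) (powLength_jordanBlock m j)).trans ?_
      simp [KleinTableau.ofList, KleinTableau.union, KleinTableau.ofIndec]
    · refine (congrArg (· + _) (powLength_prod (M := JordanBlock k m) (N := JordanBlock k r)
        j)).trans ?_
      simp [powLength_jordanBlock, KleinTableau.ofList, KleinTableau.union, KleinTableau.ofIndec,
        add_assoc]

theorem cols_eq_of_amb_equiv {l l' : List Indec}
    (e : (sumObj k l).amb ≃ₗ[k[X]] (sumObj k l').amb) :
    (KleinTableau.ofList l).cols = (KleinTableau.ofList l').cols := by
  refine Multiset.eq_of_sum_map_tsub_eq (KleinTableau.zero_notMem_cols l)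
    (KleinTableau.zero_notMem_cols l') fun j => ?_
  have h := powLength_congr e j
  rw [powLength_amb_sumObj, powLength_amb_sumObj] at h
  exact_mod_cast h

end cols

/-! ### Recovering the summands from columns, arcs and poles -/

namespace Indec

/-- The indecomposable summand contributing an empty column of length `m`. -/
def ofEmptyColumn (m : ℕ) : Indec :=
  if h : 1 ≤ m then .P 0 m (by omega) (by omega) h else .P 0 1 (by omega) (by omega) le_rfl

/-- The indecomposable summand contributing a pole at `m`. -/
def ofPole (m : ℕ) : Indec :=
  if h : 1 ≤ m then .P 1 m (by omega) h h else .P 0 1 (by omega) (by omega) le_rfl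

/-- The indecomposable summand contributing the arc `p`. -/
def ofArc (p : ℕ × ℕ) : Indec :=
  if h : 1 ≤ p.2 ∧ p.2 + 2 ≤ p.1 then .B p.1 p.2 h.1 h.2
  else if h : 2 ≤ p.1 then .P 2 p.1 le_rfl h (by omega)
  else .P 0 1 (by omega) (by omega) le_rfl

/-- The lengths of the columns belonging to the arc `p`. -/
def arcCols (p : ℕ × ℕ) : Multiset ℕ :=
  if p.2 + 2 ≤ p.1 then {p.1, p.2} else {p.1}

theorem ofArc_of_le {m r : ℕ} (hr : 1 ≤ r) (h : r + 2 ≤ m) : ofArc (m, r) = .B m r hr h := by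
  simp [ofArc, hr, h]

theorem ofArc_pred {m : ℕ} (h : 2 ≤ m) : ofArc (m, m - 1) = .P 2 m le_rfl h (by omega) := by
  have h' : ¬ (1 ≤ m - 1 ∧ m - 1 + 2 ≤ m) := by omega
  simp only [ofArc]
  rw [dif_neg h', dif_pos h]

theorem ofPole_of_le {m : ℕ} (h : 1 ≤ m) : ofPole m = .P 1 m (by omega) h h := by
  simp [ofPole, h]

/-- The lengths of the empty columns `P_0^m` in a list of indecomposables. -/
def emptyColumns : List Indec → Multiset ℕ
  | [] => 0
  | .P 0 m _ _ _ :: l => m ::ₘ emptyColumns l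
  | _ :: l => emptyColumns l

/-- The vertices of the summands `P_1^m` in a list of indecomposables. -/
def poles : List Indec → Multiset ℕ
  | [] => 0
  | .P 1 m _ _ _ :: l => m ::ₘ poles l
  | _ :: l => poles l

end Indec

namespace KleinTableau

open Indec

/-- In `P_2^m` and in a bipicket the entry `1` lies at the end of the arc, so the excess entries `1`
come from the summands `P_1^m` alone. -/
theorem ones_ofList (l : List Indec) :
    (ofList l).ones = poles l + (ofList l).twos.map Prod.snd := by
  induction l with
  | nil => simp [ofList, empty, poles]
  | cons x l ih =>
    rcases x with ⟨_ | _ | _ | _, m, hl, hlm, hm⟩ | ⟨m, r, hr, h⟩ <;>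
      first | omega | simp [ofList, union, ofIndec, ih, poles]

/-- The term `emptyColumns l` can be found by cancellation once the columns and the arc diagram are
known. An arc `m → m - 1` accounts for the single column of `P_2^m`; a column `P_0^{m-1}` beside it
counts as empty. -/
theorem cols_ofList (l : List Indec) :
    (ofList l).cols = emptyColumns l + poles l + (ofList l).twos.bind arcCols := by
  induction l with
  | nil => simp [ofList, empty, poles, emptyColumns]
  | cons x l ih =>
    rcases x with ⟨_ | _ | _ | _, m, hl, hlm, hm⟩ | ⟨m, r, hr, h⟩
    · simp [ofList, union, ofIndec, ih, poles, emptyColumns]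
    · simp [ofList, union, ofIndec, ih, poles, emptyColumns]
    · have : ¬ (m - 1 + 2 ≤ m) := by omega
      simp [ofList, union, ofIndec, ih, poles, emptyColumns, arcCols, this]
    · omega
    · simp [ofList, union, ofIndec, ih, poles, emptyColumns, arcCols, h]

/-- On data coming from a list the vertices are positive and the arcs descend, so the fallback value
`.P 0 1` is never taken. -/
theorem coe_eq (l : List Indec) :
    (l : Multiset Indec) = (emptyColumns l).map ofEmptyColumn + (poles l).map ofPole +
      (ofList l).twos.map ofArc := by
  induction l with
  | nil => simp [ofList, empty, poles, emptyColumns]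
  | cons x l ih =>
    rw [← Multiset.cons_coe, ih]
    rcases x with ⟨_ | _ | _ | _, m, hl, hlm, hm⟩ | ⟨m, r, hr, h⟩
    · simp [ofList, union, ofIndec, poles, emptyColumns, ofEmptyColumn, hm]
    · simp [ofList, union, ofIndec, poles, emptyColumns, ofPole, hm]
    · simp [ofList, union, ofIndec, poles, emptyColumns, ofArc_pred hlm]
    · omega
    · simp [ofList, union, ofIndec, poles, emptyColumns, ofArc, h, hr]

theorem arcDiagram_ofList (l : List Indec) :
    (ofList l).arcDiagram = ⟨(ofList l).twos, poles l⟩ := by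
  rw [arcDiagram, ones_ofList, add_tsub_cancel_right]

/-- The arc diagram and the column lengths determine a direct sum of pickets and bipickets. -/
theorem perm_of_arcDiagram_eq {l l' : List Indec} (hc : (ofList l).cols = (ofList l').cols)
    (h : (ofList l).arcDiagram = (ofList l').arcDiagram) : l.Perm l' := by
  rw [arcDiagram_ofList, arcDiagram_ofList, ArcDiagram.mk.injEq] at h
  rw [cols_ofList, cols_ofList, h.1, h.2, add_left_inj, add_left_inj] at hc
  rw [← Multiset.coe_eq_coe, coe_eq, coe_eq, h.1, h.2, hc]

theorem lt_of_mem_twos {l : List Indec} {p : ℕ × ℕ} (hp : p ∈ (ofList l).twos) :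
    1 ≤ p.2 ∧ p.2 < p.1 := by
  induction l with
  | nil => simp [ofList, empty] at hp
  | cons x l ih =>
    rcases x with ⟨_ | _ | _ | _, m, hl, hlm, hm⟩ | ⟨m, r, hr, h⟩
    · exact ih (by simpa [ofList, union, ofIndec] using hp)
    · exact ih (by simpa [ofList, union, ofIndec] using hp)
    · rcases Multiset.mem_add.1 hp with hp | hp
      · rw [ofIndec, Multiset.mem_singleton] at hp
        · subst hp; simp only; omega
        · simp
        · simp
      · exact ih hp
    · omega
    · rcases Multiset.mem_add.1 hp with hp | hp
      · rw [ofIndec, Multiset.mem_singleton] at hp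
        subst hp; simp only; omega
      · exact ih hp

theorem poles_append (l l' : List Indec) : poles (l ++ l') = poles l + poles l' := by
  induction l with
  | nil => simp [poles]
  | cons x l ih =>
    rcases x with ⟨_ | _ | _ | _, m, hl, hlm, hm⟩ | ⟨m, r, hr, h⟩ <;>
      first | omega | simp [poles, ih]

theorem arcDiagram_append (l l' : List Indec) :
    (ofList (l ++ l')).arcDiagram = (ofList l).arcDiagram + (ofList l').arcDiagram := by
  rw [arcDiagram_ofList, arcDiagram_ofList, arcDiagram_ofList, poles_append, ofList_append]
  rfl

/-- If the arc diagram of a list contains given arcs and poles, then the list contains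
the corresponding indecomposables. -/
theorem exists_perm_append {l : List Indec} {D : ArcDiagram} {A : List (ℕ × ℕ)} {B : List ℕ}
    (h : (ofList l).arcDiagram = D + ⟨A, B⟩) :
    ∃ l', l.Perm (A.map ofArc ++ B.map ofPole ++ l') := by
  rw [arcDiagram_ofList] at h
  have h1 : (ofList l).twos = D.arcs + A := congrArg ArcDiagram.arcs h
  have h2 : poles l = D.poles + B := congrArg ArcDiagram.poles h
  have h3 := coe_eq l
  rw [h1, h2, Multiset.map_add, Multiset.map_add, Multiset.map_coe, Multiset.map_coe] at h3
  refine ⟨((emptyColumns l).map ofEmptyColumn + D.poles.map ofPole +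
    D.arcs.map ofArc).toList, ?_⟩
  rw [← Multiset.coe_eq_coe, h3, ← Multiset.coe_add, ← Multiset.coe_add, Multiset.coe_toList]
  abel

theorem ofList_eq_of_perm {l l' : List Indec} (h : l.Perm l') :
    ofList l = ofList l' := by
  induction h with
  | nil => rfl
  | cons x _ ih => rw [ofList, ofList, ih]
  | swap x y l =>
    ext1 <;> exact add_left_comm _ _ _
  | trans _ _ ih ih' => exact ih.trans ih'

end KleinTableau

/-! ### A uniform model for `B_2^{m,r}` with `1 ≤ r < m` -/

/-- If the second component factors through the first, the shear `(y, z) ↦ (y, z - p y)` removes it.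
-/
theorem exists_equiv_prod_of_comp_eq {R A M N Z : Type*} [CommRing R] [AddCommGroup A]
    [Module R A] [AddCommGroup M] [Module R M] [AddCommGroup N] [Module R N] [AddCommGroup Z]
    [Module R Z] [Subsingleton Z] (a : A →ₗ[R] M) (b : A →ₗ[R] N) (c : Z →ₗ[R] N)
    (p : M →ₗ[R] N) (h : ∀ x, p (a x) = b x) :
    ∃ (e : A ≃ₗ[R] A × Z) (e' : (M × N) ≃ₗ[R] M × N), ∀ x, a.prodMap c (e x) = e' (a.prod b x) := by
  let _ : Unique Z := uniqueOfSubsingleton 0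
  refine ⟨LinearEquiv.prodUnique.symm,
    (LinearEquiv.refl _ _).skewProd (LinearEquiv.refl _ _) (-p), fun x => ?_⟩
  have hz : (LinearEquiv.prodUnique (R := R) (M := A) (M₂ := Z)).symm x = (x, 0) :=
    Prod.ext rfl (Subsingleton.elim _ _)
  simp [hz, h]

section linkedPair

variable (k : Type u) [Field k]

/-- The embedding `k[T]/(T^2) → k[T]/(T^m) ⊕ k[T]/(T^r)`, `1 ↦ (T^(m-2), T^(r-1))`, where
`1 ≤ r < m`. -/
noncomputable def linkedPair (m r : ℕ) (hr : 1 ≤ r) (h : r < m) : InvSubspace k where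
  sub := JordanBlock k 2
  amb := JordanBlock k m × JordanBlock k r
  incl := (mulPow k 2 m (m - 2) (by omega)).prod (mulPow k 2 r (r - 1) (by omega))
  incl_injective := fun _ _ hxy =>
    mulPow_injective' k 2 m (by omega) (by omega) (congrArg Prod.fst hxy)
  finite_amb := inferInstance
  nilpotent_amb := by
    refine ⟨m, fun x => Prod.ext (pow_smul k m x.1) ?_⟩
    change (X : k[X]) ^ m • x.2 = 0
    obtain ⟨c, rfl⟩ : ∃ c, m = c + r := ⟨m - r, by omega⟩
    rw [pow_add, mul_smul, pow_smul, smul_zero]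

theorem extBipicket_eq_bipicket {m r : ℕ} (hr : 1 ≤ r) (h : r < m) (h' : r + 2 ≤ m) :
    extBipicket k m r hr h = bipicket k m r hr h' := dif_pos h'

theorem extBipicket_eq_dsum {m r : ℕ} (hr : 1 ≤ r) (h : r < m) (h' : m = r + 1) :
    extBipicket k m r hr h =
      (picket k 2 m (by omega)).dsum (picket k 0 r (Nat.zero_le r)) := dif_neg (by omega)

theorem linkedPair_isIso_extBipicket (m r : ℕ) (hr : 1 ≤ r) (h : r < m) :
    (linkedPair k m r hr h).IsIso (extBipicket k m r hr h) := by
  rcases Nat.lt_or_ge m (r + 2) with h' | h'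
  · rw [extBipicket_eq_dsum k hr h (by omega)]
    -- Here `m - 2 = r - 1`, so the projection `k[T]/(T^m) → k[T]/(T^r)` takes `T^(m-2)` to
    -- `T^(r-1)`.
    obtain ⟨e, e', he⟩ := exists_equiv_prod_of_comp_eq (mulPow k 2 m (m - 2) (by omega))
      (mulPow k 2 r (r - 1) (by omega)) (mulPow k 0 r (r - 0) (by omega))
      (mulPow k m r 0 (by omega)) fun x => mulPow_mulPow_of_eq x
    exact .of_equiv (Y := linkedPair k m r hr h)
      (Z := (picket k 2 m (by omega)).dsum (picket k 0 r (Nat.zero_le r))) e e' he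
  · rw [extBipicket_eq_bipicket k hr h h']
    exact .refl _

end linkedPair

/-! ### The exact sequences behind the moves -/

/-- The embeddings `i`, `j`, `l` of modules are the terms of a short exact sequence. -/
def EmbeddingsExact {R A A' B B' C C' : Type*} [CommRing R] [AddCommGroup A] [Module R A]
    [AddCommGroup A'] [Module R A'] [AddCommGroup B] [Module R B] [AddCommGroup B'] [Module R B']
    [AddCommGroup C] [Module R C] [AddCommGroup C'] [Module R C']
    (i : A →ₗ[R] A') (j : B →ₗ[R] B') (l : C →ₗ[R] C') : Prop :=
  ∃ (f : A →ₗ[R] B) (f' : A' →ₗ[R] B') (g : B →ₗ[R] C) (g' : B' →ₗ[R] C'),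
    (∀ x, j (f x) = f' (i x)) ∧ (∀ x, l (g x) = g' (j x)) ∧
    Function.Injective f ∧ Function.Injective f' ∧ Function.Exact f g ∧ Function.Exact f' g' ∧
    Function.Surjective g ∧ Function.Surjective g'

section EmbeddingsExact

variable {R : Type*} [CommRing R] {A B M N P Q : Type*} [AddCommGroup A] [Module R A]
  [AddCommGroup B] [Module R B] [AddCommGroup M] [Module R M] [AddCommGroup N] [Module R N]
  [AddCommGroup P] [Module R P] [AddCommGroup Q] [Module R Q]

theorem LinearMap.exact_id_prod_sub (t : A →ₗ[R] B) :
    Function.Injective (LinearMap.id.prod t) ∧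
    Function.Exact (LinearMap.id.prod t) (t ∘ₗ LinearMap.fst R A B - LinearMap.snd R A B) ∧
    Function.Surjective (t ∘ₗ LinearMap.fst R A B - LinearMap.snd R A B) := by
  refine ⟨fun x y h => congrArg Prod.fst h, fun x => ⟨fun h => ⟨x.1, Prod.ext rfl ?_⟩, ?_⟩,
    fun x => ⟨(0, -x), by simp⟩⟩
  · exact sub_eq_zero.1 h
  · rintro ⟨x, rfl⟩
    simp

/-- With `t = id`, the ambient maps are `(x, y) ↦ ((p x, y), (x, q y))` and `((u, y), (x, v)) ↦ (u -
p x, q y - v)`. Here `p` and `q` become the inclusions of block `n` into block `m` and of block `s`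
into block `r`. -/
theorem embeddingsExact_moveA (a : A →ₗ[R] N) (b : A →ₗ[R] Q) (p : N →ₗ[R] M) (q : Q →ₗ[R] P)
    (a' : A →ₗ[R] M) (b' : A →ₗ[R] P) (ha : ∀ x, p (a x) = a' x) (hb : ∀ x, q (b x) = b' x) :
    EmbeddingsExact (a.prod b) ((a'.prod b).prodMap (a.prod b')) (a'.prod b') := by
  obtain ⟨h1, h2, h3⟩ := LinearMap.exact_id_prod_sub (LinearMap.id : A →ₗ[R] A)
  refine ⟨_, .prod (p.prodMap .id) (LinearMap.prodMap .id q), _,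
    .prod (LinearMap.fst _ _ _ ∘ₗ LinearMap.fst _ _ _ - p ∘ₗ LinearMap.fst _ _ _ ∘ₗ LinearMap.snd _ _ _)
      (q ∘ₗ LinearMap.snd _ _ _ ∘ₗ LinearMap.fst _ _ _ - LinearMap.snd _ _ _ ∘ₗ LinearMap.snd _ _ _),
    fun x => ?_, fun x => ?_, h1, fun x y h => ?_, h2, fun x => ⟨fun h => ?_, ?_⟩, h3,
    fun x => ⟨((x.1, 0), (0, -x.2)), by simp⟩⟩
  · simp [ha, hb]
  · simp [ha, hb]
  · exact Prod.ext (congrArg (fun z => z.2.1) h) (congrArg (fun z => z.1.2) h)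
  · have h1 := sub_eq_zero.1 (congrArg Prod.fst h)
    have h2 := sub_eq_zero.1 (congrArg Prod.snd h)
    exact ⟨(x.2.1, x.1.2), Prod.ext (Prod.ext h1.symm rfl) (Prod.ext rfl h2)⟩
  · rintro ⟨x, rfl⟩
    simp

/-- Here `t` will be the projection `k[T]/(T^2) → k[T]/(T)`, and `q` the inclusion of block `s` into
block `r`. -/
theorem embeddingsExact_moveB (t : A →ₗ[R] B) (a : A →ₗ[R] M) (b : A →ₗ[R] N) (c : B →ₗ[R] P)
    (a' : A →ₗ[R] P) (c' : B →ₗ[R] N) (q : P →ₗ[R] N) (h : ∀ x, c (t x) = a' x)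
    (h' : ∀ x, q (c x) = c' x) (hb : ∀ x, q (a' x) = b x) :
    EmbeddingsExact (a.prod a') ((a.prod b).prodMap c) c' := by
  obtain ⟨h1, h2, h3⟩ := LinearMap.exact_id_prod_sub t
  refine ⟨_, .prod (LinearMap.prodMap .id q) (LinearMap.snd _ _ _), _,
    LinearMap.snd _ _ _ ∘ₗ LinearMap.fst _ _ _ - q ∘ₗ LinearMap.snd _ _ _, fun x => ?_, fun x => ?_, h1,
    fun x y h => ?_, h2, fun x => ⟨fun h => ?_, ?_⟩, h3, fun x => ⟨((0, x), 0), by simp⟩⟩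
  · simp [h, hb]
  · simp [← h', ← hb, h]
  · exact Prod.ext (congrArg (fun z => z.1.1) h) (congrArg (fun z => z.2) h)
  · exact ⟨(x.1.1, x.2), Prod.ext (Prod.ext rfl (sub_eq_zero.1 h).symm) rfl⟩
  · rintro ⟨x, rfl⟩
    simp

/-- The block `r` ends an arc in the first term and starts one in the middle term, so the generator
goes to `T^(r-1)` in one and to `T^(r-2)` in the other. Taking `t` to be multiplication by `T` makes
up the difference, and it kills the component in block `s`. -/
theorem embeddingsExact_moveC (t : A →ₗ[R] A) (a : A →ₗ[R] M) (b : A →ₗ[R] N) (c : A →ₗ[R] P)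
    (d : A →ₗ[R] Q) (q : P →ₗ[R] N) (c' : A →ₗ[R] P) (b' : A →ₗ[R] N)
    (hc : ∀ x, c (t x) = c' x) (hd : ∀ x, d (t x) = 0) (hb : ∀ x, q (c' x) = b x)
    (hq : ∀ x, q (c x) = b' x) :
    EmbeddingsExact (a.prod c') ((a.prod b).prodMap (c.prod d)) (b'.prod d) := by
  obtain ⟨h1, h2, h3⟩ := LinearMap.exact_id_prod_sub t
  refine ⟨_, .prod (LinearMap.prodMap .id q) (.prod (LinearMap.snd _ _ _) 0), _,
    .prod (LinearMap.snd _ _ _ ∘ₗ LinearMap.fst _ _ _ - q ∘ₗ LinearMap.fst _ _ _ ∘ₗ LinearMap.snd _ _ _)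
      (-(LinearMap.snd _ _ _ ∘ₗ LinearMap.snd _ _ _)), fun x => ?_, fun x => ?_, h1,
    fun x y h => ?_, h2, fun x => ⟨fun h => ?_, ?_⟩, h3,
    fun x => ⟨((0, x.1), (0, -x.2)), by simp⟩⟩
  · simp [hc, hb, hd]
  · simp [hd, ← hq, ← hb, hc]
  · exact Prod.ext (congrArg (fun z => z.1.1) h) (congrArg (fun z => z.2.1) h)
  · have h1 := sub_eq_zero.1 (congrArg Prod.fst h)
    have h2 := neg_eq_zero.1 (congrArg Prod.snd h)
    exact ⟨(x.1.1, x.2.1), Prod.ext (Prod.ext rfl h1.symm) (Prod.ext rfl h2.symm)⟩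
  · rintro ⟨x, rfl⟩
    simp

/-- As for (C), with `t` the inclusion of the socle `k[T]/(T) → k[T]/(T^2)`. -/
theorem embeddingsExact_moveD (t : B →ₗ[R] A) (a : B →ₗ[R] M) (c : A →ₗ[R] P) (d : A →ₗ[R] Q)
    (q : P →ₗ[R] M) (c' : B →ₗ[R] P) (a' : A →ₗ[R] M) (hc : ∀ x, c (t x) = c' x)
    (hd : ∀ x, d (t x) = 0) (ha : ∀ x, q (c' x) = a x) (hq : ∀ x, q (c x) = a' x) :
    EmbeddingsExact c' (a.prodMap (c.prod d)) (a'.prod d) := by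
  obtain ⟨h1, h2, h3⟩ := LinearMap.exact_id_prod_sub t
  refine ⟨_, .prod q (.prod .id 0), _,
    .prod (LinearMap.fst _ _ _ - q ∘ₗ LinearMap.fst _ _ _ ∘ₗ LinearMap.snd _ _ _) (-(LinearMap.snd _ _ _ ∘ₗ LinearMap.snd _ _ _)),
    fun x => ?_, fun x => ?_, h1,
    fun x y h => ?_, h2, fun x => ⟨fun h => ?_, ?_⟩, h3, fun x => ⟨(x.1, (0, -x.2)), by simp⟩⟩
  · simp [hc, ha, hd]
  · simp [hd, ← hq, ← ha, hc]
  · exact congrArg (fun z => z.2.1) h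
  · have h1 := sub_eq_zero.1 (congrArg Prod.fst h)
    have h2 := neg_eq_zero.1 (congrArg Prod.snd h)
    exact ⟨x.2.1, Prod.ext h1.symm (Prod.ext rfl h2.symm)⟩
  · rintro ⟨x, rfl⟩
    simp

end EmbeddingsExact

namespace InvSubspace

variable {k : Type u} [Field k]

theorem isExtension_of_embeddingsExact {U M V : InvSubspace k}
    (h : EmbeddingsExact U.incl M.incl V.incl) : IsExtension U M V := by
  obtain ⟨f, f', g, g', h1, h2, h⟩ := h
  exact ⟨⟨f, f', h1⟩, ⟨g, g', h2⟩, h⟩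

theorem isExtension_moveA (m n r s : ℕ) (hs : 1 ≤ s) (hsr : s < r) (hrn : r < n) (hnm : n < m)
    (hr : 1 ≤ r) (hsn : s < n) (hsm : s < m) (hrm : r < m) :
    IsExtension (linkedPair k n s hs hsn)
      ((linkedPair k m s hs hsm).dsum (linkedPair k n r hr hrn)) (linkedPair k m r hr hrm) :=
  isExtension_of_embeddingsExact <| embeddingsExact_moveA _ _
    (mulPow k n m (m - n) (by omega)) (mulPow k s r (r - s) (by omega)) _ _
    (fun x => mulPow_mulPow_of_eq x) (fun x => mulPow_mulPow_of_eq x)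

theorem isExtension_moveB (m r s : ℕ) (hs : 1 ≤ s) (hsr : s < r) (hrm : r < m) (hr : 1 ≤ r)
    (hsm : s < m) :
    IsExtension (linkedPair k m s hs hsm)
      ((linkedPair k m r hr hrm).dsum (picket k 1 s hs)) (picket k 1 r hr) :=
  isExtension_of_embeddingsExact <| embeddingsExact_moveB (mulPow k 2 1 0 (by omega)) _ _ _ _ _
    (mulPow k s r (r - s) (by omega)) (fun x => mulPow_mulPow_of_eq x)
    (fun x => mulPow_mulPow_of_eq x) (fun x => mulPow_mulPow_of_eq x)

theorem isExtension_moveC (m n r s : ℕ) (hs : 1 ≤ s) (hsr : s < r) (hrn : r < n) (hnm : n < m)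
    (hr : 1 ≤ r) (hn : 1 ≤ n) (hsn : s < n) (hrm : r < m) :
    IsExtension (linkedPair k m r hr hrm)
      ((linkedPair k m n hn hnm).dsum (linkedPair k r s hs hsr)) (linkedPair k n s hs hsn) :=
  isExtension_of_embeddingsExact <| embeddingsExact_moveC (mulPow k 2 2 1 (by omega)) _ _ _ _
    (mulPow k r n (n - r) (by omega)) _ _ (fun x => mulPow_mulPow_of_eq x)
    -- The total exponent `1 + (s - 1) = s` annihilates the block `k[T]/(T^s)`.
    (fun x => (mulPow_mulPow_of_eq (c := s) x).trans (mulPow_eq_zero _ le_rfl x))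
    (fun x => mulPow_mulPow_of_eq x) (fun x => mulPow_mulPow_of_eq x)

theorem isExtension_moveD (m r s : ℕ) (hs : 1 ≤ s) (hsr : s < r) (hrm : r < m) (hr : 1 ≤ r)
    (hm : 1 ≤ m) (hsm : s < m) :
    IsExtension (picket k 1 r hr)
      ((picket k 1 m hm).dsum (linkedPair k r s hs hsr)) (linkedPair k m s hs hsm) :=
  isExtension_of_embeddingsExact <| embeddingsExact_moveD (mulPow k 1 2 1 (by omega)) _ _ _
    (mulPow k r m (m - r) (by omega)) _ _ (fun x => mulPow_mulPow_of_eq x)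
    (fun x => (mulPow_mulPow_of_eq (c := s) x).trans (mulPow_eq_zero _ le_rfl x))
    (fun x => mulPow_mulPow_of_eq x) (fun x => mulPow_mulPow_of_eq x)

end InvSubspace

/-! ### Moves realised on lists of summands -/

/-- The indecomposable summands of `B_2^{m,r}`, where `1 ≤ r < m`. -/
def Indec.extBipicketList (m r : ℕ) (hr : 1 ≤ r) (h : r < m) : List Indec :=
  if h' : r + 2 ≤ m then [.B m r hr h']
  else [.P 2 m le_rfl (by omega) (by omega), .P 0 r (by omega) (by omega) hr]

theorem ofList_extBipicketList (m r : ℕ) (hr : 1 ≤ r) (h : r < m) :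
    ofList (extBipicketList m r hr h) = ⟨{m, r}, {r}, {(m, r)}⟩ := by
  unfold extBipicketList
  split_ifs with h'
  · simp [ofList, union, ofIndec, empty]
  · obtain rfl : m = r + 1 := by omega
    simp [ofList, union, ofIndec, empty]

theorem cols_extBipicketList (m r : ℕ) (hr : 1 ≤ r) (h : r < m) :
    (ofList (extBipicketList m r hr h)).cols = {m, r} := by
  rw [ofList_extBipicketList]

theorem arcDiagram_extBipicketList (m r : ℕ) (hr : 1 ≤ r) (h : r < m) :
    (ofList (extBipicketList m r hr h)).arcDiagram = ⟨{(m, r)}, 0⟩ := by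
  simp [arcDiagram, ofList_extBipicketList]

namespace InvSubspace

variable {k : Type u} [Field k]

theorem extBipicket_isIso_sumObj (m r : ℕ) (hr : 1 ≤ r) (h : r < m) :
    (extBipicket k m r hr h).IsIso (sumObj k (extBipicketList m r hr h)) := by
  unfold extBipicket extBipicketList
  split_ifs with h'
  · exact (sumObj_singleton k (.B m r hr h')).symm
  · exact (sumObj_pair k (.P 2 m le_rfl (by omega) (by omega))
      (.P 0 r (by omega) (by omega) hr)).symm

theorem HasArcDiagram.of_list {Y : InvSubspace k} {D : ArcDiagram} (l : List Indec)
    (h : Y.IsIso (sumObj k l)) (hD : (ofList l).arcDiagram = D) : Y.HasArcDiagram D :=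
  ⟨_, ⟨l, h, rfl⟩, hD⟩

/-- `0 → U → M → V → 0` is a short exact sequence, the middle term and the direct sum of the end
terms of which are the sums of the lists `f` and `e`, with the same columns. -/
structure RealizesMove (U M V : InvSubspace k) (f e : List Indec) : Prop where
  isExtension : IsExtension U M V
  middle : M.IsIso (sumObj k f)
  ends : (U.dsum V).IsIso (sumObj k e)
  cols_eq : (ofList f).cols = (ofList e).cols

theorem RealizesMove.witnesses {U M V : InvSubspace k} {D E : ArcDiagram} {f e : List Indec}
    (h : RealizesMove U M V f e) (hD : (ofList f).arcDiagram = D) (hE : (ofList e).arcDiagram = E) :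
    Witnesses U M V D E :=
  ⟨h.isExtension, .of_list f h.middle hD, .of_list e h.ends hE⟩

/-- The summands `e` are split off from `l`, and the remaining ones are added to the exact sequence;
this gives one further step of the ext order. -/
theorem RealizesMove.exists_list {U M V : InvSubspace k} {D₀ : ArcDiagram} {A : List (ℕ × ℕ)}
    {B : List ℕ} {f e : List Indec} (h : RealizesMove U M V f e)
    (hE : (ofList e).arcDiagram = ⟨A, B⟩) (he : A.map ofArc ++ B.map ofPole = e) {l : List Indec}
    (hl : (ofList l).arcDiagram = D₀ + ⟨A, B⟩) :
    ∃ l', (ofList l').arcDiagram = D₀ + (ofList f).arcDiagram ∧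
      (ofList l').cols = (ofList l).cols ∧
      ∀ Y : InvSubspace k, Y.ExtLE (sumObj k l') → Y.ExtLE (sumObj k l) := by
  obtain ⟨t, ht⟩ := exists_perm_append hl
  rw [he] at ht
  have ht' := ht.trans List.perm_append_comm
  refine ⟨t ++ f, ?_, ?_, fun Y hY => ?_⟩
  · rw [arcDiagram_append]
    congr 1
    -- Superposition of diagrams is cancellative, so the remaining summands `t` have diagram `D₀`.
    rw [ofList_eq_of_perm ht', arcDiagram_append, hE] at hl
    exact ArcDiagram.ext (add_right_cancel (congrArg ArcDiagram.arcs hl))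
      (add_right_cancel (congrArg ArcDiagram.poles hl))
  · rw [ofList_eq_of_perm ht', ofList_append, ofList_append, union, union, h.cols_eq]
  · have h1 : Y.ExtLE (M.dsum (sumObj k t)) := hY.congr_right
      ((h.middle.dsum_congr (.refl _)).trans
        ((sumObj_append k f t).symm.trans (sumObj_perm k List.perm_append_comm)))
    refine (h1.trans_isExtension (h.isExtension.dsum_right _)).congr_right ?_
    exact (sumObj_perm k ht).trans ((sumObj_append k _ t).trans
      ((h.ends.symm.dsum_congr (.refl _)).trans (IsIso.dsum_assoc _ _ _)))

theorem realizesMove_A (m n r s : ℕ) (hs : 1 ≤ s) (hsr : s < r) (hrn : r < n) (hnm : n < m)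
    (hr : 1 ≤ r) (hsn : s + 2 ≤ n) (hsm : s < m) (hrm : r + 2 ≤ m) :
    RealizesMove (bipicket k n s hs hsn)
      ((extBipicket k m s hs hsm).dsum (extBipicket k n r hr hrn)) (bipicket k m r hr hrm)
      (extBipicketList m s hs hsm ++ extBipicketList n r hr hrn)
      [.B m r hr hrm, .B n s hs hsn] where
  isExtension := (isExtension_moveA m n r s hs hsr hrn hnm hr (by omega) hsm (by omega)).congr_middle
    ((linkedPair_isIso_extBipicket k _ _ _ _).dsum_congr (linkedPair_isIso_extBipicket k _ _ _ _))
  middle := ((extBipicket_isIso_sumObj _ _ _ _).dsum_congr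
      (extBipicket_isIso_sumObj _ _ _ _)).trans (sumObj_append k _ _).symm
  ends := (IsIso.dsum_comm _ _).trans
    (sumObj_pair k (.B m r hr hrm) (.B n s hs hsn)).symm
  cols_eq := by
    rw [ofList_append, union, cols_extBipicketList, cols_extBipicketList]
    simp only [ofList, union, empty, ofIndec, Multiset.insert_eq_cons, ← Multiset.singleton_add]
    abel

theorem realizesMove_B (m r s : ℕ) (hs : 1 ≤ s) (hsr : s < r) (hrm : r < m) (hr : 1 ≤ r)
    (hsm : s + 2 ≤ m) :
    RealizesMove (bipicket k m s hs hsm)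
      ((extBipicket k m r hr hrm).dsum (picket k 1 s hs)) (picket k 1 r hr)
      (extBipicketList m r hr hrm ++ [.P 1 s one_le_two hs hs])
      [.B m s hs hsm, .P 1 r one_le_two hr hr] where
  isExtension := (isExtension_moveB m r s hs hsr hrm hr (by omega)).congr_middle
    ((linkedPair_isIso_extBipicket k _ _ _ _).dsum_congr (.refl _))
  middle := ((extBipicket_isIso_sumObj _ _ _ _).dsum_congr
      (sumObj_singleton k (.P 1 s one_le_two hs hs)).symm).trans (sumObj_append k _ _).symm
  ends := (sumObj_pair k (.B m s hs hsm) (.P 1 r one_le_two hr hr)).symm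
  cols_eq := by
    rw [ofList_append, union, cols_extBipicketList]
    simp only [ofList, union, empty, ofIndec, Multiset.insert_eq_cons, ← Multiset.singleton_add]
    abel

theorem realizesMove_C (m n r s : ℕ) (hs : 1 ≤ s) (hsr : s < r) (hrn : r < n) (hnm : n < m)
    (hr : 1 ≤ r) (hn : 1 ≤ n) (hsn : s + 2 ≤ n) (hrm : r + 2 ≤ m) :
    RealizesMove (bipicket k m r hr hrm)
      ((extBipicket k m n hn hnm).dsum (extBipicket k r s hs hsr)) (bipicket k n s hs hsn)
      (extBipicketList m n hn hnm ++ extBipicketList r s hs hsr)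
      [.B m r hr hrm, .B n s hs hsn] where
  isExtension := (isExtension_moveC m n r s hs hsr hrn hnm hr hn (by omega) (by omega)).congr_middle
    ((linkedPair_isIso_extBipicket k _ _ _ _).dsum_congr (linkedPair_isIso_extBipicket k _ _ _ _))
  middle := ((extBipicket_isIso_sumObj _ _ _ _).dsum_congr
      (extBipicket_isIso_sumObj _ _ _ _)).trans (sumObj_append k _ _).symm
  ends := (sumObj_pair k (.B m r hr hrm) (.B n s hs hsn)).symm
  cols_eq := by
    rw [ofList_append, union, cols_extBipicketList, cols_extBipicketList]
    simp only [ofList, union, empty, ofIndec, Multiset.insert_eq_cons, ← Multiset.singleton_add]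
    abel

theorem realizesMove_D (m r s : ℕ) (hs : 1 ≤ s) (hsr : s < r) (hrm : r < m) (hr : 1 ≤ r)
    (hm : 1 ≤ m) (hsm : s + 2 ≤ m) :
    RealizesMove (picket k 1 r hr)
      ((picket k 1 m hm).dsum (extBipicket k r s hs hsr)) (bipicket k m s hs hsm)
      ([.P 1 m one_le_two hm hm] ++ extBipicketList r s hs hsr)
      [.B m s hs hsm, .P 1 r one_le_two hr hr] where
  isExtension := (isExtension_moveD m r s hs hsr hrm hr hm (by omega)).congr_middle
    ((IsIso.refl _).dsum_congr (linkedPair_isIso_extBipicket k _ _ _ _))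
  middle := ((sumObj_singleton k (.P 1 m one_le_two hm hm)).symm.dsum_congr
    (extBipicket_isIso_sumObj _ _ _ _)).trans (sumObj_append k _ _).symm
  ends := (IsIso.dsum_comm _ _).trans
    (sumObj_pair k (.B m s hs hsm) (.P 1 r one_le_two hr hr)).symm
  cols_eq := by
    rw [ofList_append, union, cols_extBipicketList]
    simp only [ofList, union, empty, ofIndec, Multiset.insert_eq_cons, ← Multiset.singleton_add]
    abel

end InvSubspace

/-! ### Arc diagrams of the terms, and the passage from moves to extensions -/

section arcDiagrams

variable {m n r s : ℕ}

theorem arcDiagram_B_B (hr : 1 ≤ r) (h : r + 2 ≤ m) (hs : 1 ≤ s) (h' : s + 2 ≤ n) :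
    (ofList [.B m r hr h, .B n s hs h']).arcDiagram = ⟨{(m, r), (n, s)}, 0⟩ := by
  rw [arcDiagram_ofList]; rfl

theorem arcDiagram_B_P (hs : 1 ≤ s) (h : s + 2 ≤ m) (hl : 1 ≤ 2) (hr : 1 ≤ r) (hr' : 1 ≤ r) :
    (ofList [.B m s hs h, .P 1 r hl hr hr']).arcDiagram = ⟨{(m, s)}, {r}⟩ := by
  rw [arcDiagram_ofList]; rfl

theorem arcDiagram_extBipicketList_append (hr : 1 ≤ r) (h : r < m) (hs : 1 ≤ s) (h' : s < n) :
    (ofList (extBipicketList m r hr h ++ extBipicketList n s hs h')).arcDiagram =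
      ⟨{(m, r), (n, s)}, 0⟩ := by
  rw [arcDiagram_append, arcDiagram_extBipicketList, arcDiagram_extBipicketList]; rfl

theorem arcDiagram_extBipicketList_append_P (hr : 1 ≤ r) (h : r < m) (hl : 1 ≤ 2) (hs : 1 ≤ s)
    (hs' : 1 ≤ s) :
    (ofList (extBipicketList m r hr h ++ [.P 1 s hl hs hs'])).arcDiagram = ⟨{(m, r)}, {s}⟩ := by
  rw [arcDiagram_append, arcDiagram_extBipicketList, arcDiagram_ofList]; rfl

theorem arcDiagram_P_append_extBipicketList (hs : 1 ≤ s) (h : s < r) (hl : 1 ≤ 2) (hm : 1 ≤ m)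
    (hm' : 1 ≤ m) :
    (ofList ([.P 1 m hl hm hm'] ++ extBipicketList r s hs h)).arcDiagram = ⟨{(r, s)}, {m}⟩ := by
  rw [arcDiagram_append, arcDiagram_extBipicketList, arcDiagram_ofList]; rfl

end arcDiagrams

theorem exists_list_of_move (k : Type u) [Field k] {D : ArcDiagram} {l : List Indec}
    (h : ArcDiagram.Move D (ofList l).arcDiagram) :
    ∃ l', (ofList l').arcDiagram = D ∧ (ofList l').cols = (ofList l).cols ∧
      ∀ Y : InvSubspace k, Y.ExtLE (sumObj k l') → Y.ExtLE (sumObj k l) := by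
  -- A move by itself allows the vertex `0`; the exact sequences need `s ≥ 1`, which holds because
  -- the diagram comes from a tableau.
  have hpos : ∀ p ∈ (ofList l).arcDiagram.arcs, 1 ≤ p.2 := fun p hp => (lt_of_mem_twos hp).1
  generalize hE : (ofList l).arcDiagram = E at h hpos
  cases h with
  | A D₀ m n r s hnm hrn hsr =>
    have hs : 1 ≤ s := hpos (n, s) (Multiset.mem_add.2 (.inr (by simp)))
    rw [← arcDiagram_extBipicketList_append hs (by omega) (by omega) hrn]
    exact (realizesMove_A m n r s hs hsr hrn hnm (by omega) (by omega) (by omega) (by omega)).exists_list (A := [(m, r), (n, s)]) (B := [])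
      (arcDiagram_B_B _ _ _ _) (by simp [ofArc_of_le, *, show 1 ≤ r by omega,
        show r + 2 ≤ m by omega, show s + 2 ≤ n by omega]) hE
  | B D₀ m r s hrm hsr =>
    have hs : 1 ≤ s := hpos (m, s) (Multiset.mem_add.2 (.inr (by simp)))
    rw [← arcDiagram_extBipicketList_append_P (by omega) hrm (by omega) hs hs]
    exact (realizesMove_B m r s hs hsr hrm (by omega) (by omega)).exists_list (A := [(m, s)]) (B := [r])
      (arcDiagram_B_P _ _ _ _ _) (by simp [ofArc_of_le, ofPole_of_le, *, show 1 ≤ r by omega,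
        show s + 2 ≤ m by omega]) hE
  | C D₀ m n r s hnm hrn hsr =>
    have hs : 1 ≤ s := hpos (n, s) (Multiset.mem_add.2 (.inr (by simp)))
    rw [← arcDiagram_extBipicketList_append (by omega) hnm hs hsr]
    exact (realizesMove_C m n r s hs hsr hrn hnm (by omega) (by omega) (by omega) (by omega)).exists_list (A := [(m, r), (n, s)]) (B := [])
      (arcDiagram_B_B _ _ _ _) (by simp [ofArc_of_le, *, show 1 ≤ r by omega,
        show r + 2 ≤ m by omega, show s + 2 ≤ n by omega]) hE
  | D D₀ m r s hrm hsr =>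
    have hs : 1 ≤ s := hpos (m, s) (Multiset.mem_add.2 (.inr (by simp)))
    rw [← arcDiagram_P_append_extBipicketList hs hsr (by omega) (show 1 ≤ m by omega) (by omega)]
    exact (realizesMove_D m r s hs hsr hrm (by omega) (by omega) (by omega)).exists_list (A := [(m, s)]) (B := [r])
      (arcDiagram_B_P _ _ _ _ _) (by simp [ofArc_of_le, ofPole_of_le, *, show 1 ≤ r by omega,
        show s + 2 ≤ m by omega]) hE

/-- The induction peels off the move nearest to `l'` and keeps the columns fixed, so that without
moves both lists have equal columns and equal diagrams, hence are permutations of each other. -/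
theorem extLE_sumObj_of_arcLE (k : Type u) [Field k] {l l' : List Indec}
    (hc : (ofList l).cols = (ofList l').cols)
    (h : ArcDiagram.ArcLE (ofList l).arcDiagram (ofList l').arcDiagram) :
    (sumObj k l).ExtLE (sumObj k l') := by
  generalize hE : (ofList l').arcDiagram = E at h
  induction h generalizing l' with
  | refl => exact .of_isIso (sumObj_perm k (perm_of_arcDiagram_eq hc hE.symm))
  | tail _ hm ih =>
    subst hE
    obtain ⟨t, ht, hct, hY⟩ := exists_list_of_move k hm
    exact hY _ (ih (hc.trans hct.symm) ht)

theorem mainTheorem8 (k : Type u) [Field k] :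
    -- the arc order implies the ext order
    (∀ (a b c : ℕ) (α : a.Partition) (β : b.Partition) (γ : c.Partition) (Y Z : InvSubspace k),
      Y.InS 2 → Z.InS 2 → Y.HasType α β γ → Z.HasType α β γ → Y.ArcLE Z → Y.ExtLE Z) ∧
    -- (A)
    (∀ (m n r s : ℕ) (hs : 1 ≤ s) (hsr : s < r) (hrn : r + 1 < n) (hnm : n < m),
      InvSubspace.Witnesses
        (bipicket k n s hs (by omega))
        ((bipicket k m s hs (by omega)).dsum (bipicket k n r (by omega) (by omega)))
        (bipicket k m r (by omega) (by omega))
        ⟨{(m, s), (n, r)}, 0⟩ ⟨{(m, r), (n, s)}, 0⟩) ∧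
    -- (A')
    (∀ (m n r s : ℕ) (hs : 1 ≤ s) (hsr : s < r) (hrn : n = r + 1) (hnm : n < m),
      InvSubspace.Witnesses
        (bipicket k n s hs (by omega))
        ((bipicket k m s hs (by omega)).dsum
          ((picket k 2 n (by omega)).dsum (picket k 0 r (by omega))))
        (bipicket k m r (by omega) (by omega))
        ⟨{(m, s), (n, r)}, 0⟩ ⟨{(m, r), (n, s)}, 0⟩) ∧
    -- (B)
    (∀ (m r s : ℕ) (hs : 1 ≤ s) (hsr : s < r) (hrm : r < m),
      InvSubspace.Witnesses
        (bipicket k m s hs (by omega))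
        ((extBipicket k m r (by omega) hrm).dsum (picket k 1 s hs))
        (picket k 1 r (by omega))
        ⟨{(m, r)}, {s}⟩ ⟨{(m, s)}, {r}⟩) ∧
    -- (C)
    (∀ (m n r s : ℕ) (hs : 1 ≤ s) (hsr : s < r) (hrn : r < n) (hnm : n < m),
      InvSubspace.Witnesses
        (bipicket k m r (by omega) (by omega))
        ((extBipicket k m n (by omega) hnm).dsum (extBipicket k r s hs hsr))
        (bipicket k n s hs (by omega))
        ⟨{(m, n), (r, s)}, 0⟩ ⟨{(m, r), (n, s)}, 0⟩) ∧
    -- (D)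
    (∀ (m r s : ℕ) (hs : 1 ≤ s) (hsr : s < r) (hrm : r < m),
      InvSubspace.Witnesses
        (picket k 1 r (by omega))
        ((picket k 1 m (by omega)).dsum (extBipicket k r s hs hsr))
        (bipicket k m s hs (by omega))
        ⟨{(r, s)}, {m}⟩ ⟨{(m, s)}, {r}⟩) := by
  refine ⟨?_, fun m n r s hs hsr hrn hnm => ?_, fun m n r s hs hsr hrn hnm => ?_,
    fun m r s hs hsr hrm => ?_, fun m n r s hs hsr hrn hnm => ?_, fun m r s hs hsr hrm => ?_⟩
  · rintro a b c α β γ Y Z - - ⟨-, ⟨eY⟩, -⟩ ⟨-, ⟨eZ⟩, -⟩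
      ⟨_, _, ⟨_, ⟨l, hY, rfl⟩, rfl⟩, ⟨_, ⟨l', hZ, rfl⟩, rfl⟩, h⟩
    obtain ⟨-, e, -⟩ := hY.exists_equiv
    obtain ⟨-, e', -⟩ := hZ.exists_equiv
    -- Both ambient spaces are isomorphic to `N_β`, so the two decompositions have the same columns.
    have hc := cols_eq_of_amb_equiv (((e.symm.trans eY).trans eZ.symm).trans e')
    exact ((extLE_sumObj_of_arcLE k hc h).congr_left hY).congr_right hZ
  · have h := (realizesMove_A (k := k) m n r s hs hsr (by omega) hnm
      (by omega) (by omega) (by omega) (by omega)).witnesses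
      (arcDiagram_extBipicketList_append _ _ _ _) (arcDiagram_B_B _ _ _ _)
    rwa [extBipicket_eq_bipicket k hs _ (by omega), extBipicket_eq_bipicket k _ _ (by omega)] at h
  · have h := (realizesMove_A (k := k) m n r s hs hsr (by omega) hnm
      (by omega) (by omega) (by omega) (by omega)).witnesses
      (arcDiagram_extBipicketList_append _ _ _ _) (arcDiagram_B_B _ _ _ _)
    rwa [extBipicket_eq_bipicket k hs _ (by omega), extBipicket_eq_dsum k _ _ hrn] at h
  · exact (realizesMove_B m r s hs hsr hrm (by omega) (by omega)).witnesses
      (arcDiagram_extBipicketList_append_P _ _ _ _ _) (arcDiagram_B_P _ _ _ _ _)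
  · exact (realizesMove_C m n r s hs hsr hrn hnm (by omega) (by omega) (by omega) (by omega)).witnesses
      (arcDiagram_extBipicketList_append _ _ _ _) (arcDiagram_B_B _ _ _ _)
  · exact (realizesMove_D m r s hs hsr hrm (by omega) (by omega) (by omega)).witnesses
      (arcDiagram_P_append_extBipicketList _ _ _ _ _) (arcDiagram_B_P _ _ _ _ _)
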